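/- For a group $G$ let $\mathcal{A}_G$ be the non-commuting graph of $G$: its vertex set is $G\setminus Z(G)$, and two vertices are adjacent if and only if they do not commute in $G$. A maximum clique of a finite graph is a clique of the largest possible size. Let $q$ be a power of a prime and let $G=\mathrm{PSL}(2,q)$ or $G=\mathrm{PGL}(2,q)$. Let $a$ be a non-central element of $G$. If $G=\mathrm{PGL}(2,q)$ with $q=3$, assume moreover that $a$ is not an element of order $2$ that is a square in $G$ (under $\mathrm{PGL}(2,3)\cong S_4$ this excludes exactly the three products of two disjoint transpositions). Then there is a maximum clique of $\mathcal{A}_G$ that contains $a$. -/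

import Mathlib

open scoped MatrixGroups

/-- The non-commuting graph of a group `G`: its vertices are the non-central elements of `G`, and
two vertices are joined whenever they do not commute. -/
def nonCommutingGraph (G : Type*) [Group G] :
    SimpleGraph {g : G // g ∉ Subgroup.center G} where
  Adj a b := (a : G) * b ≠ b * a
  symm := ⟨fun _ _ h => h.symm⟩
  loopless := ⟨fun _ h => h rfl⟩

instance finite_PSL (n F : Type*) [Fintype n] [DecidableEq n] [CommRing F] [Finite F] :
    Finite (Matrix.ProjectiveSpecialLinearGroup n F) := by
  have : Finite (Matrix.SpecialLinearGroup n F) :=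
    Finite.of_injective (fun A : Matrix.SpecialLinearGroup n F => (A : Matrix n n F))
      Subtype.val_injective
  infer_instance

instance finite_PGL (n F : Type*) [Fintype n] [DecidableEq n] [CommRing F] [Finite F] :
    Finite (Matrix.ProjGenLinGroup n F) :=
  Finite.of_surjective _ Matrix.ProjGenLinGroup.mk_surjective

/-- The clique `X` of a graph on a finite vertex set can be extended to a maximum clique: some
clique of the largest possible size contains `X`. -/
def ExtendsToMaximumClique {V : Type*} [Finite V] (Γ : SimpleGraph V) (X : Finset V) : Prop :=
  ∃ Y : Finset V, Γ.IsMaximumClique Y ∧ X ⊆ Y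

/-! Commuting is an equivalence relation on elements with abelian centralizer. If these centralizers
cover the group, a clique meets each class's centralizer at most once, so one representative per
class gives a maximum clique. A vertex `a` may replace a representative if it commutes with no other
class.

In PGL(2, F), an element with `x ^ 2 ≠ 1` lifts to a matrix of nonzero trace, so commuting with it
holds exactly, not just up to a scalar, and its centralizer is abelian. Only an involution `a`
commuting with such an `x` needs care. All such `x` lie in one class, being polynomials in the lift
`A`; any other involution `y` commuting with `a` has a lift `Y` anticommuting with `A`. A suitable
`α + βY` then commutes with `Y` but not projectively with `A`, so `y` has no abelian centralizer.
Invertibility of `α + βY` fails to be attainable only in the excluded case over the field of three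
elements. -/

/-! ### Maximum cliques through a given vertex -/

section Group

variable {G : Type*} [Group G]

/-- `x` is non-central and its centralizer is commutative. -/
def HasAbelianCentralizer (x : G) : Prop :=
  x ∉ Subgroup.center G ∧ ∀ y z : G, Commute x y → Commute x z → Commute y z

/-- Commuting is an equivalence relation on the elements with abelian centralizer. -/
def abelianCentralizerSetoid (G : Type*) [Group G] :
    Setoid {x : G // HasAbelianCentralizer x} where
  r x y := Commute (x : G) y
  iseqv :=
    { refl := fun x => Commute.refl (x : G)
      symm := fun h => Commute.symm h
      trans := fun {_ y _} hxy hyz => y.2.2 _ _ hxy.symm hyz }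

/-- If the abelian centralizers cover `G`, and one of them contains every element with abelian
centralizer that commutes with `a`, then `a` lies in a maximum clique. -/
theorem extendsToMaximumClique_singleton [Finite {g : G // g ∉ Subgroup.center G}]
    (hcover : ∀ g : G, g ∉ Subgroup.center G → ∃ x, HasAbelianCentralizer x ∧ Commute g x)
    {a : G} (ha : a ∉ Subgroup.center G) {x : G} (hx : HasAbelianCentralizer x)
    (hx' : ∀ y, HasAbelianCentralizer y → Commute a y → Commute x y) :
    ExtendsToMaximumClique (nonCommutingGraph G) {⟨a, ha⟩} := by
  classical
  let S := abelianCentralizerSetoid G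
  have : Finite {x : G // HasAbelianCentralizer x} :=
    Finite.of_injective
      (fun x => (⟨x.1, x.2.1⟩ : {g : G // g ∉ Subgroup.center G}))
      fun x y h => Subtype.ext (Subtype.mk.inj h)
  have : Finite (Quotient S) := Quotient.finite S
  have := Fintype.ofFinite (Quotient S)
  let q₀ : Quotient S := Quotient.mk S ⟨x, hx⟩
  let r : Quotient S → {g : G // g ∉ Subgroup.center G} := fun q =>
    if q = q₀ then ⟨a, ha⟩ else ⟨q.out.1, q.out.2.1⟩
  have key : ∀ q, q ≠ q₀ → ¬ Commute a q.out.1 := fun q hq h =>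
    hq ((Quotient.out_eq q).symm.trans (Quotient.sound (Commute.symm (hx' _ q.out.2 h))))
  have hr : ∀ q q', q ≠ q' → ¬ Commute (r q : G) (r q') := by
    intro q q' hne
    by_cases h : q = q₀
    · have h' : q' ≠ q₀ := fun h' => hne (h.trans h'.symm)
      simpa [r, h, h'] using key q' h'
    · by_cases h' : q' = q₀
      · simpa [r, h, h'] using fun hc : Commute _ a => key q h hc.symm
      · simp only [r, h, h', if_false]
        intro hc
        exact hne ((Quotient.out_eq q).symm.trans ((Quotient.sound hc).trans (Quotient.out_eq q')))
  have hinj : Function.Injective r := fun q q' h => by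
    by_contra hne
    exact hr q q' hne (h ▸ Commute.refl _)
  refine ⟨Finset.univ.image r, ⟨?_, fun Z hZ => ?_⟩, ?_⟩
  · intro u hu v hv huv
    simp only [Finset.coe_image, Finset.coe_univ, Set.image_univ, Set.mem_range] at hu hv
    obtain ⟨q, rfl⟩ := hu
    obtain ⟨q', rfl⟩ := hv
    exact hr q q' fun h => huv (h ▸ rfl)
  · choose f hf hcf using hcover
    rw [Finset.card_image_of_injective _ hinj]
    -- Send each clique member to the class of an abelian centralizer containing it; two members in
    -- one class would commute.
    refine Finset.card_le_card_of_injOn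
      (fun z => Quotient.mk S ⟨f z.1 z.2, hf z.1 z.2⟩) (by simp) fun z hz w hw h => ?_
    by_contra hne
    have hzw : Commute (f z.1 z.2) (f w.1 w.2) := Quotient.exact h
    have hz' := (hcf z.1 z.2).symm
    have hw' : Commute (f z.1 z.2) w.1 := (hf w.1 w.2).2 _ _ hzw.symm (hcf w.1 w.2).symm
    exact hZ hz hw hne ((hf z.1 z.2).2 _ _ hz' hw')
  · simp only [Finset.singleton_subset_iff, Finset.mem_image, Finset.mem_univ, true_and]
    exact ⟨q₀, by simp [r]⟩

/-- Otherwise the centralizer has exponent two, hence is abelian. -/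
theorem exists_commute_sq_ne_one {a : G} (ha : a ∉ Subgroup.center G)
    (h : ¬ HasAbelianCentralizer a) : ∃ x, Commute a x ∧ x ^ 2 ≠ 1 := by
  by_contra! hsq
  refine h ⟨ha, fun y z hy hz => ?_⟩
  have hyy := hsq y hy
  have hzz := hsq z hz
  have hyz := hsq (y * z) (hy.mul_right hz)
  rw [sq] at hyy hzz hyz
  have h1 : y⁻¹ = y := inv_eq_of_mul_eq_one_left hyy
  have h2 : z⁻¹ = z := inv_eq_of_mul_eq_one_left hzz
  have h3 : (y * z)⁻¹ = y * z := inv_eq_of_mul_eq_one_left hyz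
  rw [mul_inv_rev, h1, h2] at h3
  exact h3.symm

theorem extendsToMaximumClique_of_involution_centralizers
    [Finite {g : G // g ∉ Subgroup.center G}]
    (hab : ∀ x y z : G, x ^ 2 ≠ 1 → Commute x y → Commute x z → Commute y z)
    (hrot : ∀ a x y : G, a ≠ 1 → x ^ 2 ≠ 1 → y ^ 2 ≠ 1 → Commute a x → Commute a y → Commute x y)
    {a : G} (ha : a ∉ Subgroup.center G)
    (hinv : ∀ x y : G, a ^ 2 = 1 → Commute a x → x ^ 2 ≠ 1 → y ^ 2 = 1 → y ≠ 1 → y ≠ a →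
      Commute a y → ∃ z, Commute y z ∧ ¬ Commute a z) :
    ExtendsToMaximumClique (nonCommutingGraph G) {⟨a, ha⟩} := by
  have hsq : ∀ g x : G, g ∉ Subgroup.center G → Commute g x → x ^ 2 ≠ 1 →
      ¬ HasAbelianCentralizer g → HasAbelianCentralizer x := by
    intro g x hg hgx hx hng
    refine ⟨fun hxc => hng ⟨hg, fun y z _ _ => ?_⟩, fun y z => hab x y z hx⟩
    exact hab x y z hx (Subgroup.mem_center_iff.mp hxc y).symm
      (Subgroup.mem_center_iff.mp hxc z).symm
  have hcover : ∀ g : G, g ∉ Subgroup.center G → ∃ x, HasAbelianCentralizer x ∧ Commute g x := by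
    intro g hg
    by_cases h : HasAbelianCentralizer g
    · exact ⟨g, h, Commute.refl g⟩
    · obtain ⟨x, hgx, hx⟩ := exists_commute_sq_ne_one hg h
      exact ⟨x, hsq g x hg hgx hx h, hgx⟩
  by_cases hN : HasAbelianCentralizer a
  · exact extendsToMaximumClique_singleton hcover ha hN fun _ _ h => h
  obtain ⟨x, hax, hx⟩ := exists_commute_sq_ne_one ha hN
  have ha1 : a ≠ 1 := fun h => ha (h ▸ Subgroup.one_mem _)
  have ha2 : a ^ 2 = 1 := by
    by_contra h
    exact hN ⟨ha, fun y z => hab a y z h⟩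
  refine extendsToMaximumClique_singleton hcover ha (hsq a x ha hax hx hN) fun y hy hay => ?_
  by_cases hy2 : y ^ 2 = 1
  · by_cases hya : y = a
    · exact hya ▸ hax.symm
    have hy1 : y ≠ 1 := fun h => hy.1 (h ▸ Subgroup.one_mem _)
    obtain ⟨z, hyz, hz⟩ := hinv x y ha2 hax hx hy2 hy1 hya hay
    exact absurd (hy.2 _ _ hay.symm hyz) hz
  · exact hrot a x y ha1 hx hy2 hax hay

end Group

/-! ### Two by two matrices -/

section Matrix

open Matrix

variable {F : Type*} [Field F]

theorem sq_eq_trace_smul_sub_det (A : Matrix (Fin 2) (Fin 2) F) :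
    A * A = A.trace • A - A.det • (1 : Matrix (Fin 2) (Fin 2) F) := by
  ext i j
  fin_cases i <;> fin_cases j <;>
    simp [Matrix.mul_apply, Fin.sum_univ_two, Matrix.trace_fin_two, Matrix.det_fin_two] <;> ring

theorem trace_ne_zero_of_sq {A : Matrix (Fin 2) (Fin 2) F}
    (h : ∀ u : F, A * A ≠ u • (1 : Matrix (Fin 2) (Fin 2) F)) : A.trace ≠ 0 := fun h0 =>
  h (-A.det) (by rw [sq_eq_trace_smul_sub_det, h0]; simp)

theorem trace_eq_zero_of_sq {A : Matrix (Fin 2) (Fin 2) F}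
    (hA : ∀ u : F, A ≠ u • (1 : Matrix (Fin 2) (Fin 2) F)) {s : F}
    (h : A * A = s • (1 : Matrix (Fin 2) (Fin 2) F)) : A.trace = 0 := by
  by_contra h0
  rw [sq_eq_trace_smul_sub_det, sub_eq_iff_eq_add, ← add_smul] at h
  exact hA (A.trace⁻¹ * (s + A.det)) (by rw [mul_smul, ← h, smul_smul, inv_mul_cancel₀ h0, one_smul])

/-- Conjugation by `A` preserves the trace, so `X` and `u • X` have equal traces. -/
theorem eq_one_of_trace_ne_zero {A X : Matrix (Fin 2) (Fin 2) F} (hA : IsUnit A)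
    (hX : X.trace ≠ 0) {u : F} (h : A * X = u • (X * A)) : u = 1 := by
  obtain ⟨A, rfl⟩ := hA
  have h1 : X.trace = u * X.trace := by
    have := congrArg (fun M => Matrix.trace (M * (↑A⁻¹ : Matrix (Fin 2) (Fin 2) F))) h
    simpa [Matrix.trace_mul_comm, ← Matrix.mul_assoc, Matrix.trace_mul_cycle] using this
  exact (mul_right_cancel₀ hX (by rw [one_mul, ← h1])).symm

theorem exists_eq_smul_one_add_smul {A X : Matrix (Fin 2) (Fin 2) F}
    (hA : ∀ u : F, A ≠ u • (1 : Matrix (Fin 2) (Fin 2) F)) (h : A * X = X * A) :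
    ∃ α β : F, X = α • (1 : Matrix (Fin 2) (Fin 2) F) + β • A := by
  have e00 := congrFun (congrFun h 0) 0
  have e01 := congrFun (congrFun h 0) 1
  have e10 := congrFun (congrFun h 1) 0
  simp only [Matrix.mul_apply, Fin.sum_univ_two] at e00 e01 e10
  -- Commuting makes these three coordinates of `X` proportional to those of `A`; nonscalarity
  -- supplies a nonzero one to divide by.
  have solve : ∀ β : F, X 0 1 = β * A 0 1 → X 1 0 = β * A 1 0 →
      X 1 1 - X 0 0 = β * (A 1 1 - A 0 0) →
      ∃ α β : F, X = α • (1 : Matrix (Fin 2) (Fin 2) F) + β • A := by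
    intro β h1 h2 h3
    refine ⟨X 0 0 - β * A 0 0, β, ?_⟩
    ext i j
    fin_cases i <;> fin_cases j <;> simp [h1, h2]
    linear_combination h3
  by_cases h01 : A 0 1 = 0
  · by_cases h10 : A 1 0 = 0
    · have hd : A 1 1 - A 0 0 ≠ 0 := fun hd => hA (A 0 0) (by
        ext i j
        fin_cases i <;> fin_cases j <;> simp [h01, h10]
        exact sub_eq_zero.mp hd)
      refine solve ((X 1 1 - X 0 0) / (A 1 1 - A 0 0)) ?_ ?_ (by field_simp)
      · rw [h01, mul_zero]
        refine (mul_eq_zero.mp ?_).resolve_left hd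
        rw [h01] at e01
        linear_combination -e01
      · rw [h10, mul_zero]
        refine (mul_eq_zero.mp ?_).resolve_left hd
        rw [h10] at e10
        linear_combination e10
    · refine solve (X 1 0 / A 1 0) ?_ (by field_simp) ?_ <;> field_simp
      · linear_combination -e00
      · linear_combination -e10
  · refine solve (X 0 1 / A 0 1) (by field_simp) ?_ ?_ <;> field_simp
    · linear_combination e00
    · linear_combination e01

theorem commute_of_commute_of_nonscalar {A X Y : Matrix (Fin 2) (Fin 2) F}
    (hA : ∀ u : F, A ≠ u • (1 : Matrix (Fin 2) (Fin 2) F)) (hX : A * X = X * A)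
    (hY : A * Y = Y * A) : X * Y = Y * X := by
  obtain ⟨α, β, rfl⟩ := exists_eq_smul_one_add_smul hA hX
  simp [add_mul, mul_add, hY]

theorem det_smul_one_add_smul {A : Matrix (Fin 2) (Fin 2) F} (hA : A.trace = 0) (α β : F) :
    (α • (1 : Matrix (Fin 2) (Fin 2) F) + β • A).det = α ^ 2 + β ^ 2 * A.det := by
  rw [Matrix.trace_fin_two] at hA
  simp [Matrix.det_fin_two]
  linear_combination α * β * hA

/-- Moving `A` across turns `α + βY` into `α - βY`; comparing coefficients of `Y` and of `1` forces
both `u = -1` and `u = 1`. -/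
theorem not_smul_commute_of_anticommute {A Y : Matrix (Fin 2) (Fin 2) F} (hA : IsUnit A)
    (hY : ∀ u : F, Y ≠ u • (1 : Matrix (Fin 2) (Fin 2) F)) (hAY : A * Y = -(Y * A)) {α β : F}
    (hα : 2 * α ≠ 0) (hβ : β ≠ 0) (u : F) :
    A * (α • (1 : Matrix (Fin 2) (Fin 2) F) + β • Y) ≠
      u • ((α • (1 : Matrix (Fin 2) (Fin 2) F) + β • Y) * A) := by
  intro h
  have h1 : ((α - u * α) • (1 : Matrix (Fin 2) (Fin 2) F) - (β + u * β) • Y) * A = 0 * A := by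
    simp only [mul_add, add_mul, smul_add, mul_smul_comm, hAY, smul_mul_assoc, mul_one, one_mul,
      smul_smul, sub_mul, add_smul, sub_smul, smul_neg] at h ⊢
    rw [zero_mul, ← sub_eq_zero.mpr h]
    abel
  have h2 := sub_eq_zero.mp (hA.mul_right_cancel h1)
  have h3 : β + u * β = 0 := by
    by_contra h0
    exact hY ((β + u * β)⁻¹ * (α - u * α))
      (by rw [mul_smul, h2, smul_smul, inv_mul_cancel₀ h0, one_smul])
  have hu : u = -1 := by
    refine mul_right_cancel₀ hβ ?_
    linear_combination h3
  have h4 := congrFun (congrFun h2 0) 0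
  rw [h3] at h4
  simp [hu] at h4
  exact hα (by linear_combination h4)

/-- Two invertible matrices whose classes modulo scalars are distinct commuting involutions
anticommute, if the first commutes modulo scalars with a matrix whose class is not an
involution; the latter is then a combination of the first and the identity. -/
theorem anticommute_of_involutions {A Y X : Matrix (Fin 2) (Fin 2) F} (hAu : IsUnit A)
    (hYu : IsUnit Y)
    (hA : ∀ u : F, A ≠ u • (1 : Matrix (Fin 2) (Fin 2) F))
    (hY : ∀ u : F, Y ≠ u • (1 : Matrix (Fin 2) (Fin 2) F))
    (hX : ∀ u : F, X * X ≠ u • (1 : Matrix (Fin 2) (Fin 2) F))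
    {s t u v : F} (hA2 : A * A = s • (1 : Matrix (Fin 2) (Fin 2) F))
    (hY2 : Y * Y = t • (1 : Matrix (Fin 2) (Fin 2) F))
    (hAX : A * X = u • (X * A)) (hAY : A * Y = v • (Y * A)) (hne : ∀ w : F, Y ≠ w • A) :
    A.trace = 0 ∧ Y.trace = 0 ∧ A * Y = -(Y * A) ∧
      ∃ α β : F, X = α • (1 : Matrix (Fin 2) (Fin 2) F) + β • A ∧ 2 * α ≠ 0 ∧ β ≠ 0 := by
  have tA := trace_eq_zero_of_sq hA hA2
  have tY := trace_eq_zero_of_sq hY hY2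
  have hu := eq_one_of_trace_ne_zero hAu (trace_ne_zero_of_sq hX) hAX
  rw [hu, one_smul] at hAX
  obtain ⟨α, β, rfl⟩ := exists_eq_smul_one_add_smul hA hAX
  have htr := trace_ne_zero_of_sq hX
  have hα : 2 * α ≠ 0 := by
    intro h
    apply htr
    rw [Matrix.trace_add, Matrix.trace_smul, Matrix.trace_smul, tA]
    simp [mul_comm α, h]
  have hβ : β ≠ 0 := by
    rintro rfl
    exact hX (α * α) (by simp [smul_smul])
  have h2 : (2 : F) ≠ 0 := left_ne_zero_of_mul hα
  refine ⟨tA, tY, ?_, α, β, rfl, hα, hβ⟩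
  have hv : v * v = 1 := by
    have hd := congrArg Matrix.det hAY
    have hAd : A.det ≠ 0 := ((Matrix.isUnit_iff_isUnit_det A).mp hAu).ne_zero
    have hYd : Y.det ≠ 0 := ((Matrix.isUnit_iff_isUnit_det Y).mp hYu).ne_zero
    simp only [Matrix.det_mul, Matrix.det_smul, Fintype.card_fin] at hd
    refine mul_right_cancel₀ (mul_ne_zero hAd hYd) ?_
    linear_combination -hd
  rcases mul_self_eq_one_iff.mp hv with rfl | rfl
  -- If `v = 1`, then `Y` is a traceless combination of `1` and `A`, hence a multiple of `A`.
  · rw [one_smul] at hAY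
    obtain ⟨γ, δ, rfl⟩ := exists_eq_smul_one_add_smul hA hAY
    rw [Matrix.trace_add, Matrix.trace_smul, Matrix.trace_smul, tA] at tY
    have hγ : γ = 0 := by simpa [h2] using tY
    exact absurd (by simp [hγ]) (hne δ)
  · simpa using hAY

end Matrix

/-! ### Commutation in the projective linear groups -/

section Projective

open Matrix

variable {F : Type*} [Field F]

namespace Matrix.ProjGenLinGroup

theorem mk_eq_mk_iff_smul {A B : GL (Fin 2) F} :
    mk A = mk B ↔ ∃ u : F, (B : Matrix (Fin 2) (Fin 2) F) = u • (A : Matrix (Fin 2) (Fin 2) F) := by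
  rw [mk_eq_mk_iff]
  constructor
  · rintro ⟨u, rfl⟩
    refine ⟨u, ?_⟩
    ext i j
    fin_cases i <;> fin_cases j <;> simp [Matrix.mul_apply, mul_comm]
  · rintro ⟨u, hu⟩
    have hu0 : u ≠ 0 := by
      rintro rfl
      rw [zero_smul] at hu
      exact B.ne_zero hu
    refine ⟨Units.mk0 u hu0, Units.ext ?_⟩
    rw [hu]
    ext i j
    fin_cases i <;> fin_cases j <;> simp [Matrix.mul_apply, mul_comm]

theorem mk_eq_one_iff_smul {A : GL (Fin 2) F} :
    mk A = 1 ↔ ∃ u : F, (A : Matrix (Fin 2) (Fin 2) F) = u • (1 : Matrix (Fin 2) (Fin 2) F) := by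
  rw [← mk_one, eq_comm, mk_eq_mk_iff_smul]
  rfl

theorem mk_sq_eq_one_iff {A : GL (Fin 2) F} :
    mk A ^ 2 = 1 ↔ ∃ u : F, (A : Matrix (Fin 2) (Fin 2) F) * A =
      u • (1 : Matrix (Fin 2) (Fin 2) F) := by
  rw [← map_pow, mk_eq_one_iff_smul]
  simp [sq]

theorem commute_mk_iff {A B : GL (Fin 2) F} :
    Commute (mk A) (mk B) ↔ ∃ u : F, (A : Matrix (Fin 2) (Fin 2) F) * B =
      u • ((B : Matrix (Fin 2) (Fin 2) F) * A) := by
  rw [commute_iff_eq, ← map_mul, ← map_mul, eq_comm, mk_eq_mk_iff_smul]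
  simp

theorem val_commute_of_sq_ne_one {A X : GL (Fin 2) F} (hX : mk X ^ 2 ≠ 1)
    (h : Commute (mk A) (mk X)) :
    (A : Matrix (Fin 2) (Fin 2) F) * X = X * A := by
  obtain ⟨u, hu⟩ := commute_mk_iff.mp h
  rw [Ne, mk_sq_eq_one_iff, not_exists] at hX
  rw [eq_one_of_trace_ne_zero A.isUnit (trace_ne_zero_of_sq hX) hu, one_smul] at hu
  exact hu

theorem commute_of_commute_sq_ne_one {x y z : PGL(2, F)} (hx : x ^ 2 ≠ 1) (hy : Commute x y)
    (hz : Commute x z) : Commute y z := by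
  induction x using induction_on with | mk X =>
  induction y using induction_on with | mk Y =>
  induction z using induction_on with | mk Z =>
  have hX : mk X ≠ 1 := fun h => hx (by rw [h, one_pow])
  rw [Ne, mk_eq_one_iff_smul, not_exists] at hX
  exact commute_mk_iff.mpr ⟨1, by
    rw [one_smul]
    exact commute_of_commute_of_nonscalar hX (val_commute_of_sq_ne_one hx hy.symm).symm
      (val_commute_of_sq_ne_one hx hz.symm).symm⟩

theorem commute_of_sq_ne_one_of_commute {a x y : PGL(2, F)} (ha : a ≠ 1) (hx : x ^ 2 ≠ 1)
    (hy : y ^ 2 ≠ 1) (hax : Commute a x) (hay : Commute a y) : Commute x y := by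
  induction a using induction_on with | mk A =>
  induction x using induction_on with | mk X =>
  induction y using induction_on with | mk Y =>
  rw [Ne, mk_eq_one_iff_smul, not_exists] at ha
  exact commute_mk_iff.mpr ⟨1, by
    rw [one_smul]
    exact commute_of_commute_of_nonscalar ha (val_commute_of_sq_ne_one hx hax)
      (val_commute_of_sq_ne_one hy hay)⟩

theorem anticommute_of_involutions_mk {A X Y : GL (Fin 2) F} (ha : mk A ^ 2 = 1)
    (hax : Commute (mk A) (mk X)) (hx : mk X ^ 2 ≠ 1) (hy : mk Y ^ 2 = 1) (hy1 : mk Y ≠ 1)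
    (hya : mk Y ≠ mk A) (hay : Commute (mk A) (mk Y)) (ha1 : mk A ≠ 1) :
    A.val.trace = 0 ∧ Y.val.trace = 0 ∧ A.val * Y.val = -(Y.val * A.val) ∧
      ∃ α β : F, X.val = α • (1 : Matrix (Fin 2) (Fin 2) F) + β • A.val ∧ 2 * α ≠ 0 ∧ β ≠ 0 := by
  obtain ⟨s, hs⟩ := mk_sq_eq_one_iff.mp ha
  obtain ⟨t, ht⟩ := mk_sq_eq_one_iff.mp hy
  obtain ⟨u, hu⟩ := commute_mk_iff.mp hax
  obtain ⟨v, hv⟩ := commute_mk_iff.mp hay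
  rw [Ne, mk_sq_eq_one_iff, not_exists] at hx
  rw [Ne, mk_eq_one_iff_smul, not_exists] at hy1 ha1
  rw [ne_comm, Ne, mk_eq_mk_iff_smul, not_exists] at hya
  exact anticommute_of_involutions A.isUnit Y.isUnit ha1 hy1 hx hs ht hu hv hya

theorem exists_commute_involution [Finite F] {a x y : PGL(2, F)}
    (hexc : ¬ (Nat.card F = 3 ∧ orderOf a = 2 ∧ IsSquare a)) (ha1 : a ≠ 1) (ha : a ^ 2 = 1)
    (hax : Commute a x) (hx : x ^ 2 ≠ 1) (hy : y ^ 2 = 1) (hy1 : y ≠ 1) (hya : y ≠ a)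
    (hay : Commute a y) : ∃ z, Commute y z ∧ ¬ Commute a z := by
  induction a using induction_on with | mk A =>
  induction x using induction_on with | mk X =>
  induction y using induction_on with | mk Y =>
  obtain ⟨tA, tY, hAY, α, β, hX, hα, hβ⟩ :=
    anticommute_of_involutions_mk ha hax hx hy hy1 hya hay ha1
  have h2 : (2 : F) ≠ 0 := left_ne_zero_of_mul hα
  rw [Ne, mk_eq_one_iff_smul, not_exists] at hy1
  suffices h : ∃ ε : F, ε ≠ 0 ∧ 1 + ε ^ 2 * Y.val.det ≠ 0 by
    obtain ⟨ε, hε, hdet⟩ := h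
    have hZ : ((1 : F) • (1 : Matrix (Fin 2) (Fin 2) F) + ε • Y.val).det ≠ 0 := by
      rwa [det_smul_one_add_smul tY, one_pow]
    refine ⟨mk (GeneralLinearGroup.mkOfDetNeZero _ hZ), commute_mk_iff.mpr ⟨1, ?_⟩, fun h => ?_⟩
    · simp [GeneralLinearGroup.mkOfDetNeZero, mul_add, add_mul]
    · obtain ⟨u, hu⟩ := commute_mk_iff.mp h
      exact not_smul_commute_of_anticommute A.isUnit hy1 hAY (by simpa using h2) hε u hu
  -- Failure for every `ε ≠ 0` gives `det Y = -1` and `ε ^ 2 = 1`, so the field is {0, 1, -1};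
  -- invertibility of `X` then forces `det A = 1`.
  by_contra! hbad
  have hdY : Y.val.det = -1 := by linear_combination hbad 1 one_ne_zero
  have hF : ∀ ε : F, ε ≠ 0 → ε ^ 2 = 1 := fun ε hε => by
    have := hbad ε hε
    rw [hdY] at this
    linear_combination -this
  have hF' : ∀ ε : F, ε ≠ 0 → ε = 1 ∨ ε = -1 := fun ε hε =>
    mul_self_eq_one_iff.mp ((sq ε).symm.trans (hF ε hε))
  have hα0 : α ≠ 0 := right_ne_zero_of_mul hα
  have hdX : X.val.det ≠ 0 := ((Matrix.isUnit_iff_isUnit_det X.val).mp X.isUnit).ne_zero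
  have hdA : A.val.det ≠ 0 := ((Matrix.isUnit_iff_isUnit_det A.val).mp A.isUnit).ne_zero
  rw [hX, det_smul_one_add_smul tA, hF α hα0, hF β hβ, one_mul] at hdX
  have hdA1 : A.val.det = 1 := by
    rcases hF' _ hdA with h | h
    · exact h
    · exact absurd (by rw [h]; ring) hdX
  have hcard : Nat.card F = 3 := by
    classical
    have := Fintype.ofFinite F
    have huniv : (Finset.univ : Finset F) = {0, 1, -1} := by
      ext ε
      by_cases h : ε = 0
      · simp [h]
      · simpa [h] using hF' ε h
    have h11 : (1 : F) ≠ -1 := fun h => h2 (by linear_combination h)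
    rw [Nat.card_eq_fintype_card, ← Finset.card_univ, huniv, Finset.card_insert_of_notMem,
      Finset.card_pair h11]
    simp
  refine hexc ⟨hcard, orderOf_eq_prime ha ha1, ?_⟩
  have hB : ((1 : F) • (1 : Matrix (Fin 2) (Fin 2) F) + (1 : F) • A.val).det ≠ 0 := by
    rw [det_smul_one_add_smul tA, hdA1]
    simpa [one_add_one_eq_two] using h2
  refine ⟨mk (GeneralLinearGroup.mkOfDetNeZero _ hB), ?_⟩
  rw [← map_mul, mk_eq_mk_iff_smul]
  -- Here `A² = -1`, so `(1 + A)² = 2A`.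
  refine ⟨2, ?_⟩
  have hA2 := sq_eq_trace_smul_sub_det A.val
  rw [tA, hdA1] at hA2
  simp [GeneralLinearGroup.mkOfDetNeZero, mul_add, add_mul, hA2, two_smul]
  abel

end Matrix.ProjGenLinGroup

namespace Matrix.ProjectiveSpecialLinearGroup

open Matrix.ProjGenLinGroup

theorem commute_toPGL_iff {x y : PSL(2, F)} : Commute (toPGL x) (toPGL y) ↔ Commute x y :=
  ⟨fun h => toPGL_injective (by simpa only [map_mul] using h.eq), fun h => h.map toPGL⟩

theorem toPGL_eq_one_iff {x : PSL(2, F)} : toPGL x = 1 ↔ x = 1 :=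
  map_eq_one_iff toPGL toPGL_injective

theorem toPGL_sq_eq_one_iff {x : PSL(2, F)} : toPGL x ^ 2 = 1 ↔ x ^ 2 = 1 := by
  rw [← map_pow, toPGL_eq_one_iff]

theorem exists_commute_involution {a x y : PSL(2, F)} (ha1 : a ≠ 1) (ha : a ^ 2 = 1)
    (hax : Commute a x) (hx : x ^ 2 ≠ 1) (hy : y ^ 2 = 1) (hy1 : y ≠ 1) (hya : y ≠ a)
    (hay : Commute a y) : ∃ z, Commute y z ∧ ¬ Commute a z := by
  rw [← toPGL_sq_eq_one_iff] at ha hy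
  rw [Ne, ← toPGL_sq_eq_one_iff] at hx
  rw [Ne, ← toPGL_eq_one_iff] at ha1 hy1
  rw [Ne, ← toPGL_injective.eq_iff] at hya
  simp only [← commute_toPGL_iff] at hax hay ⊢
  induction a using QuotientGroup.induction_on with | H A =>
  induction x using QuotientGroup.induction_on with | H X =>
  induction y using QuotientGroup.induction_on with | H Y =>
  rw [toPGL_mk] at *
  obtain ⟨tA, tY, hAY, α, β, hX, hα, hβ⟩ :=
    anticommute_of_involutions_mk ha hax hx hy hy1 hya hay ha1
  rw [mk_eq_one_iff_smul, not_exists] at hy1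
  have hdet : ∀ B : SL(2, F), (SpecialLinearGroup.toGL B).val.det = 1 := fun B => B.2
  have hdX := hdet X
  -- Reusing the coefficients of `X = α + βA` gives determinant one, since `A` and `Y` are traceless
  -- of equal determinant.
  have hZ : (α • (1 : Matrix (Fin 2) (Fin 2) F) + β • (SpecialLinearGroup.toGL Y).val).det = 1 := by
    rwa [hX, det_smul_one_add_smul tA, hdet, ← hdet Y, ← det_smul_one_add_smul tY, hdet] at hdX
  obtain ⟨Z, hZ'⟩ : ∃ Z : SL(2, F), (SpecialLinearGroup.toGL Z).val =
      α • (1 : Matrix (Fin 2) (Fin 2) F) + β • (SpecialLinearGroup.toGL Y).val :=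
    ⟨⟨_, hZ⟩, rfl⟩
  refine ⟨QuotientGroup.mk Z, ?_, ?_⟩
  · rw [toPGL_mk, commute_mk_iff, hZ']
    exact ⟨1, by rw [mul_add, add_mul, mul_smul_comm, mul_smul_comm, smul_mul_assoc,
      smul_mul_assoc, mul_one, one_mul, one_smul]⟩
  · rw [toPGL_mk, toPGL_mk, commute_mk_iff, hZ']
    rintro ⟨u, hu⟩
    exact not_smul_commute_of_anticommute (SpecialLinearGroup.toGL A).isUnit hy1 hAY hα hβ u hu

end Matrix.ProjectiveSpecialLinearGroup

end Projective

open Matrix Matrix.ProjGenLinGroup Matrix.ProjectiveSpecialLinearGroup in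
theorem mainTheorem8 (F : Type*) [Field F] [Finite F] :
    (∀ (a : PSL(2, F)) (ha : a ∉ Subgroup.center PSL(2, F)),
      ExtendsToMaximumClique (nonCommutingGraph PSL(2, F)) {⟨a, ha⟩}) ∧
    (∀ (a : PGL(2, F)) (ha : a ∉ Subgroup.center PGL(2, F)),
      ¬ (Nat.card F = 3 ∧ orderOf a = 2 ∧ IsSquare a) →
      ExtendsToMaximumClique (nonCommutingGraph PGL(2, F)) {⟨a, ha⟩}) := by
  refine ⟨fun a ha => ?_, fun a ha hexc => ?_⟩
  · have ha1 : a ≠ 1 := fun h => ha (h ▸ Subgroup.one_mem _)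
    refine extendsToMaximumClique_of_involution_centralizers (fun x y z hx hy hz => ?_)
      (fun a x y ha hx hy hax hay => ?_) ha fun x y h1 h2 h3 h4 h5 h6 h7 =>
        Matrix.ProjectiveSpecialLinearGroup.exists_commute_involution ha1 h1 h2 h3 h4 h5 h6 h7
    · rw [Ne, ← toPGL_sq_eq_one_iff] at hx
      rw [← commute_toPGL_iff] at hy hz ⊢
      exact commute_of_commute_sq_ne_one hx hy hz
    · rw [Ne, ← toPGL_sq_eq_one_iff] at hx hy
      rw [Ne, ← toPGL_eq_one_iff] at ha
      rw [← commute_toPGL_iff] at hax hay ⊢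
      exact commute_of_sq_ne_one_of_commute ha hx hy hax hay
  · have ha1 : a ≠ 1 := fun h => ha (h ▸ Subgroup.one_mem _)
    exact extendsToMaximumClique_of_involution_centralizers
      (fun x y z hx hy hz => commute_of_commute_sq_ne_one hx hy hz)
      (fun a x y ha hx hy hax hay => commute_of_sq_ne_one_of_commute ha hx hy hax hay) ha
      fun x y h1 h2 h3 h4 h5 h6 h7 =>
        Matrix.ProjGenLinGroup.exists_commute_involution hexc ha1 h1 h2 h3 h4 h5 h6 h7
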